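/- Let $\mathcal{O}_K$ be a Dedekind domain of characteristic zero such that $\mathcal{O}_K/\mathfrak{m}$ is finite for every maximal ideal $\mathfrak{m}$, and let $S=\operatorname{Spec}\mathcal{O}_K$. Let $\pi\colon X\to S$ be an arithmetic surface, i.e. $X$ is a normal scheme (all its local rings are integrally closed domains), $\pi$ is flat and projective (it factors as a closed immersion $X\to\mathbb{P}^n_S$, for some $n\ge 0$, followed by the projection to $S$), and the generic fibre of $\pi$ is irreducible and one-dimensional. Then each point $s\in S$ has an affine open neighbourhood $U\subseteq S$ for which there exists a finite morphism of $S$-schemes $$\rho\colon \pi^{-1}(U)\longrightarrow \mathbb{P}^1_U .$$ -/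

import Mathlib

open CategoryTheory AlgebraicGeometry

universe u

namespace ArithSurf

noncomputable section

attribute [local instance] MvPolynomial.gradedAlgebra

/-- The standard grading of `R[T₀, …, Tₙ]` by degree. -/
abbrev grading (n : ℕ) (R : Type u) [CommRing R] :
    ℕ → Submodule R (MvPolynomial (Fin (n + 1)) R) :=
  MvPolynomial.homogeneousSubmodule (Fin (n + 1)) R

/-- Projective `n`-space over a commutative ring: `ℙⁿ_R = Proj R[T₀, …, Tₙ]`. -/
def projectiveSpace (n : ℕ) (R : Type u) [CommRing R] : Scheme.{u} :=
  Proj (grading n R)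

/-- The structure morphism `ℙⁿ_R ⟶ Spec R`. -/
def projectiveSpaceToSpec (n : ℕ) (R : Type u) [CommRing R] :
    projectiveSpace n R ⟶ Spec (.of R) :=
  Proj.toSpecZero (grading n R) ≫
    Spec.map (CommRingCat.ofHom (algebraMap R (grading n R 0)))

/-- The structure morphism `ℙⁿ_U ⟶ U` over an affine open `U` of a scheme `S`, where
`ℙⁿ_U = Proj 𝒪_S(U)[T₀, …, Tₙ]` and `U ≅ Spec 𝒪_S(U)`. -/
def projectiveSpaceToOpen (n : ℕ) {S : Scheme.{u}} {U : S.Opens} (hU : IsAffineOpen U) :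
    projectiveSpace n Γ(S, U) ⟶ U.toScheme :=
  projectiveSpaceToSpec n Γ(S, U) ≫ hU.isoSpec.inv

/-- A morphism to `Spec R` is projective if it factors as a closed immersion into some `ℙⁿ_R`
followed by the structure morphism. -/
def IsProjective {R : Type u} [CommRing R] {X : Scheme.{u}} (π : X ⟶ Spec (.of R)) : Prop :=
  ∃ (n : ℕ) (i : X ⟶ projectiveSpace n R),
    IsClosedImmersion i ∧ i ≫ projectiveSpaceToSpec n R = π

/-- A scheme is normal if all its local rings are integrally closed domains. -/
def IsNormalScheme (X : Scheme.{u}) : Prop :=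
  ∀ x : X, IsDomain (X.presheaf.stalk x) ∧ IsIntegrallyClosed (X.presheaf.stalk x)

/-- `π : X ⟶ Spec R` is an arithmetic surface: `R` is a Dedekind domain of characteristic zero whose
residue fields at maximal ideals are finite, `X` is normal, `π` is flat and projective, and the
generic fibre of `π` is irreducible and one-dimensional. -/
structure IsArithmeticSurface {R : Type u} [CommRing R] [IsDomain R] {X : Scheme.{u}}
    (π : X ⟶ Spec (.of R)) : Prop where
  isDedekindDomain : IsDedekindDomain R
  charZero : CharZero R
  finite_residueField : ∀ m : Ideal R, m.IsMaximal → Finite (R ⧸ m)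
  normal : IsNormalScheme X
  flat : Flat π
  projective : IsProjective π
  irreducible_genericFiber : IrreducibleSpace (π.fiber (genericPoint (Spec (.of R))))
  dim_genericFiber : topologicalKrullDim (π.fiber (genericPoint (Spec (.of R)))) = 1

end

end ArithSurf

/-! Fix a closed point `m` and embed `X` in projective space. A map to `ℙ¹` near the fibre over `m`
is `(f : g)`, for homogeneous `f`, `g` of equal degree without common zero on that fibre. By
flatness the fibre lies in the closure of `p`, the generic point of the generic fibre. Cut this
closure by `f`, then `g`, chosen by homogeneous prime avoidance so that no component of either cut
lies over `m` (`exists_cut`, by Krull's principal ideal theorem). A common zero over `m` would give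
`p < q < r` with all three over the generic point of the base, against dimension one
(`exists_pair_forall_notMem`).

Since `π` is proper, the common zeros of `f` and `g` have closed image missing `m`, so over some
affine `U` around `m` the pair defines a morphism to `ℙ¹_U`. It is affine, because the preimages of
the two charts are the loci where `f`, resp. `g`, does not vanish; it is also proper, hence finite.
-/

namespace ArithSurf

/-! ### Homogeneous prime avoidance and hypersurface cuts. -/

section GradedRing

variable {R A : Type*} [CommRing R] [CommRing A] [Algebra R A] (𝒜 : ℕ → Submodule R A)
  [GradedAlgebra 𝒜]

/-- A point of the projective spectrum misses some homogeneous element of positive degree. -/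
lemma exists_homogeneous_notMem (p : ProjectiveSpectrum 𝒜) :
    ∃ d, 0 < d ∧ ∃ f ∈ 𝒜 d, f ∉ p.asHomogeneousIdeal.toIdeal := by
  classical
  by_contra! h
  refine p.not_irrelevant_le fun x hx ↦ ?_
  change x ∈ p.asHomogeneousIdeal.toIdeal
  rw [← DirectSum.sum_support_decompose 𝒜 x]
  refine Ideal.sum_mem _ fun c _ ↦ ?_
  rcases Nat.eq_zero_or_pos c with rfl | hc
  · have : (DirectSum.decompose 𝒜 x 0 : A) = 0 := hx
    rw [this]
    exact zero_mem _
  · exact h c hc _ (SetLike.coe_mem _)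

lemma exists_homogeneous_mem_notMem {p q : ProjectiveSpectrum 𝒜} (h : ¬ p ≤ q) :
    ∃ d, ∃ f ∈ 𝒜 d, f ∈ p.asHomogeneousIdeal.toIdeal ∧ f ∉ q.asHomogeneousIdeal.toIdeal := by
  classical
  by_contra! h'
  refine h fun x hx ↦ ?_
  change x ∈ q.asHomogeneousIdeal.toIdeal
  rw [← DirectSum.sum_support_decompose 𝒜 x]
  exact Ideal.sum_mem _ fun c _ ↦ h' c _ (SetLike.coe_mem _) (p.asHomogeneousIdeal.isHomogeneous c hx)

/-- Homogeneous prime avoidance. -/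
theorem exists_homogeneous_forall_notMem (T : Finset (ProjectiveSpectrum 𝒜)) :
    ∃ d, 0 < d ∧ ∃ f ∈ 𝒜 d, ∀ p ∈ T, f ∉ p.asHomogeneousIdeal.toIdeal := by
  classical
  induction T using Finset.strongInduction with
  | H T ih =>
    rcases T.eq_empty_or_nonempty with rfl | ⟨r, hr⟩
    · exact ⟨1, one_pos, 0, zero_mem _, by simp⟩
    -- Avoiding a prime avoids every smaller one, so non-maximal members of `T` can be dropped and
    -- `T` assumed an antichain.
    by_cases hT : ∃ p ∈ T, ∃ q ∈ T, p ≠ q ∧ p ≤ q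
    · obtain ⟨p, hp, q, hq, hpq, hle⟩ := hT
      obtain ⟨d, hd, f, hf, hfT⟩ := ih (T.erase p) (Finset.erase_ssubset hp)
      refine ⟨d, hd, f, hf, fun x hx ↦ ?_⟩
      by_cases hxp : x = p
      · subst hxp
        exact fun h ↦ hfT q (Finset.mem_erase.mpr ⟨hpq.symm, hq⟩) (hle h)
      · exact hfT x (Finset.mem_erase.mpr ⟨hxp, hx⟩)
    · push Not at hT
      obtain ⟨d, hd, f, hf, hfT⟩ := ih (T.erase r) (Finset.erase_ssubset hr)
      by_cases hfr : f ∈ r.asHomogeneousIdeal.toIdeal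
      swap
      · refine ⟨d, hd, f, hf, fun x hx ↦ ?_⟩
        by_cases hxr : x = r
        · exact hxr ▸ hfr
        · exact hfT x (Finset.mem_erase.mpr ⟨hxr, hx⟩)
      -- By the antichain property each other prime has a homogeneous element outside `r`; `g` is
      -- built as a product of these.
      have hg : ∀ S ⊆ T.erase r, ∃ e, 0 < e ∧ ∃ g ∈ 𝒜 e, g ∉ r.asHomogeneousIdeal.toIdeal ∧
          ∀ p ∈ S, g ∈ p.asHomogeneousIdeal.toIdeal := by
        intro S
        induction S using Finset.induction_on with
        | empty =>
          obtain ⟨e, he, g, hg, hgr⟩ := exists_homogeneous_notMem 𝒜 r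
          exact fun _ ↦ ⟨e, he, g, hg, hgr, by simp⟩
        | insert p S hpS ihS =>
          intro hS
          obtain ⟨e, he, g, hg, hgr, hgS⟩ := ihS ((Finset.subset_insert _ _).trans hS)
          have hp := Finset.mem_erase.mp (hS (Finset.mem_insert_self _ _))
          obtain ⟨c, k, hk, hkp, hkr⟩ :=
            exists_homogeneous_mem_notMem 𝒜 (hT p hp.2 r hr hp.1)
          refine ⟨c + e, by omega, k * g, SetLike.mul_mem_graded hk hg, fun h ↦ ?_, fun q hq ↦ ?_⟩
          · exact (r.isPrime.mem_or_mem h).elim hkr hgr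
          · rcases Finset.mem_insert.mp hq with rfl | hq
            · exact Ideal.mul_mem_right _ _ hkp
            · exact Ideal.mul_mem_left _ _ (hgS q hq)
      obtain ⟨e, he, g, hg, hgr, hgT⟩ := hg _ subset_rfl
      -- The powers equalise the degrees. At each prime of `T` exactly one of the two summands lies
      -- in it.
      refine ⟨e * d, Nat.mul_pos he hd, f ^ e + g ^ d, add_mem ?_ ?_, fun x hx ↦ ?_⟩
      · simpa using SetLike.pow_mem_graded e hf
      · simpa [mul_comm] using SetLike.pow_mem_graded d hg
      · by_cases hxr : x = r
        · subst hxr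
          rw [Ideal.add_mem_iff_right _ (Ideal.pow_mem_of_mem _ hfr _ he)]
          exact fun h ↦ hgr (x.isPrime.mem_of_pow_mem _ h)
        · have hx' := Finset.mem_erase.mpr ⟨hxr, hx⟩
          rw [Ideal.add_mem_iff_left _ (Ideal.pow_mem_of_mem _ (hgT x hx') _ hd)]
          exact fun h ↦ hfT x hx' (x.isPrime.mem_of_pow_mem _ h)

/-- The homogeneous core of `p` is a prime between `I` and `p`, so minimality makes it equal to `p`.
-/
lemma isHomogeneous_of_mem_minimalPrimes {I p : Ideal A} (hI : I.IsHomogeneous 𝒜)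
    (hp : p ∈ I.minimalPrimes) : p.IsHomogeneous 𝒜 := by
  have := hp.isPrime
  have h1 : (p.homogeneousCore 𝒜).toIdeal.IsPrime := Ideal.IsPrime.homogeneousCore this
  have h2 : I ≤ (p.homogeneousCore 𝒜).toIdeal := by
    rw [← hI.toIdeal_homogeneousCore_eq_self]
    exact Ideal.homogeneousCore_mono 𝒜 hp.1.2
  rw [Ideal.IsHomogeneous.iff_eq]
  exact le_antisymm (Ideal.toIdeal_homogeneousCore_le 𝒜 p)
    (hp.2 ⟨h1, h2⟩ (Ideal.toIdeal_homogeneousCore_le 𝒜 p))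

lemma not_irrelevant_le_of_le {I : HomogeneousIdeal 𝒜} {q : ProjectiveSpectrum 𝒜}
    (h : I ≤ q.asHomogeneousIdeal) : ¬ HomogeneousIdeal.irrelevant 𝒜 ≤ I :=
  fun h' ↦ q.not_irrelevant_le (h'.trans h)

/-- The points of the projective spectrum that are minimal over an ideal. -/
def minimalPoints (I : Ideal A) : Set (ProjectiveSpectrum 𝒜) :=
  {p | p.asHomogeneousIdeal.toIdeal ∈ I.minimalPrimes}

lemma finite_minimalPoints [IsNoetherianRing A] (I : Ideal A) : (minimalPoints 𝒜 I).Finite := by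
  refine Set.Finite.preimage (f := fun p : ProjectiveSpectrum 𝒜 ↦ p.asHomogeneousIdeal.toIdeal)
    ?_ (Ideal.finite_minimalPrimes_of_isNoetherianRing A I)
  intro p _ q _ h
  exact ProjectiveSpectrum.ext (HomogeneousIdeal.ext h)

lemma exists_minimalPoint_le {I : Ideal A} (hI : I.IsHomogeneous 𝒜) (q : ProjectiveSpectrum 𝒜)
    (h : I ≤ q.asHomogeneousIdeal.toIdeal) : ∃ p ∈ minimalPoints 𝒜 I, p ≤ q := by
  obtain ⟨p, hp, hpq⟩ := Ideal.exists_minimalPrimes_le h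
  refine ⟨⟨⟨p, isHomogeneous_of_mem_minimalPrimes 𝒜 hI hp⟩, hp.isPrime, ?_⟩, hp, hpq⟩
  exact not_irrelevant_le_of_le 𝒜 (q := q) hpq

/-- Krull's principal ideal theorem in `A ⧸ q`: there the image of `p` has height at most one,
leaving no room for a prime strictly between. -/
lemma eq_of_mem_minimalPrimes_sup_span [IsNoetherianRing A] {q r p : Ideal A} {f : A}
    (hq : q.IsPrime) (hr : r.IsPrime) (hp : p ∈ (q ⊔ Ideal.span {f}).minimalPrimes)
    (hqr : q < r) (hrp : r ≤ p) : r = p := by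
  have := hp.isPrime
  by_contra hne
  have hrp : r < p := lt_of_le_of_ne hrp hne
  let p₀ : PrimeSpectrum A := ⟨q, hq⟩
  let p₁ : PrimeSpectrum A := ⟨r, hr⟩
  let p₂ : PrimeSpectrum A := ⟨p, this⟩
  let e := q.primeSpectrumQuotientOrderIsoZeroLocus.symm
  have h : (e ⟨p₂, hqr.le.trans hrp.le⟩).1.height ≤ 1 :=
    Ideal.map_height_le_one_of_mem_minimalPrimes hp
  have h01 : e ⟨p₀, le_refl q⟩ < e ⟨p₁, hqr.le⟩ := e.lt_iff_lt.mpr hqr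
  have h12 : e ⟨p₁, hqr.le⟩ < e ⟨p₂, hqr.le.trans hrp.le⟩ := e.lt_iff_lt.mpr hrp
  have hph : (e ⟨p₁, hqr.le⟩).1.height ≤ 0 :=
    Order.lt_one_iff_nonpos.mp (Ideal.height_le_iff.mp h _ inferInstance h12)
  exact not_lt_zero (a := (e ⟨p₀, le_refl q⟩).1.height)
    (Ideal.height_le_iff.mp hph _ inferInstance h01)

lemma isHomogeneous_map_algebraMap (m : Ideal R) :
    (m.map (algebraMap R A)).IsHomogeneous 𝒜 := by
  refine Ideal.homogeneous_span 𝒜 _ ?_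
  rintro _ ⟨r, -, rfl⟩
  exact ⟨0, SetLike.algebraMap_mem_graded 𝒜 r⟩

/-- Cutting finitely many horizontal points by a suitable homogeneous element: none of the points
minimal over the result contains `m`. -/
theorem exists_cut [IsNoetherianRing A] (m : Ideal R) (T : Finset (ProjectiveSpectrum 𝒜))
    (hT : ∀ q ∈ T, ¬ m.map (algebraMap R A) ≤ q.asHomogeneousIdeal.toIdeal) :
    ∃ d, 0 < d ∧ ∃ f ∈ 𝒜 d, ∃ T' : Finset (ProjectiveSpectrum 𝒜),
      (∀ q' ∈ T', ¬ m.map (algebraMap R A) ≤ q'.asHomogeneousIdeal.toIdeal ∧ ∃ q ∈ T, q < q') ∧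
      ∀ p : ProjectiveSpectrum 𝒜, f ∈ p.asHomogeneousIdeal.toIdeal → (∃ q ∈ T, q ≤ p) →
        ∃ q' ∈ T', q' ≤ p := by
  classical
  -- The generic points of the part of the closure of `q` lying over `V(m)`; `f` must avoid these as
  -- well as `T`.
  let M (q : ProjectiveSpectrum 𝒜) : Finset (ProjectiveSpectrum 𝒜) :=
    (finite_minimalPoints 𝒜
      (q.asHomogeneousIdeal.toIdeal ⊔ m.map (algebraMap R A))).toFinset
  obtain ⟨d, hd, f, hf, hfN⟩ := exists_homogeneous_forall_notMem 𝒜 (T ∪ T.biUnion M)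
  let V (q : ProjectiveSpectrum 𝒜) : Finset (ProjectiveSpectrum 𝒜) :=
    (finite_minimalPoints 𝒜 (q.asHomogeneousIdeal.toIdeal ⊔ Ideal.span {f})).toFinset
  refine ⟨d, hd, f, hf, T.biUnion V, fun q' hq' ↦ ?_, ?_⟩
  · obtain ⟨q, hq, hq'⟩ := Finset.mem_biUnion.mp hq'
    replace hq' : q' ∈ minimalPoints 𝒜 (q.asHomogeneousIdeal.toIdeal ⊔ Ideal.span {f}) :=
      (Set.Finite.mem_toFinset _).mp hq'
    have hfq' : f ∈ q'.asHomogeneousIdeal.toIdeal :=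
      (le_sup_right.trans hq'.1.2) (Ideal.mem_span_singleton_self f)
    have hqq' : q ≤ q' := le_sup_left.trans hq'.1.2
    refine ⟨fun hm ↦ ?_, q, hq, lt_of_le_not_ge hqq' fun h ↦
      hfN q (Finset.mem_union_left _ hq) (h hfq')⟩
    -- If `q'` contained `m`, it would lie above some `r` in `M q`, with `q < r` as `q` does not
    -- contain `m`. Krull forces `r = q'`, yet `f` is in `q'` and not in `r`.
    obtain ⟨r, hr, hrq'⟩ := exists_minimalPoint_le 𝒜
      (I := q.asHomogeneousIdeal.toIdeal ⊔ m.map (algebraMap R A))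
      (q.asHomogeneousIdeal.isHomogeneous.sup (isHomogeneous_map_algebraMap 𝒜 m)) q'
      (sup_le hqq' hm)
    have hqr : q.asHomogeneousIdeal.toIdeal < r.asHomogeneousIdeal.toIdeal :=
      lt_of_le_not_ge (le_sup_left.trans hr.1.2) fun h ↦ hT q hq
        ((le_sup_right.trans hr.1.2).trans h)
    have heq := eq_of_mem_minimalPrimes_sup_span q.isPrime r.isPrime hq' hqr hrq'
    refine hfN r (Finset.mem_union_right _ (Finset.mem_biUnion.mpr ⟨q, hq, ?_⟩)) (heq ▸ hfq')
    exact (Set.Finite.mem_toFinset _).mpr hr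
  · rintro p hfp ⟨q, hq, hqp⟩
    obtain ⟨q', hq', hle⟩ := exists_minimalPoint_le 𝒜
      (I := q.asHomogeneousIdeal.toIdeal ⊔ Ideal.span {f})
      (q.asHomogeneousIdeal.isHomogeneous.sup (Ideal.homogeneous_span 𝒜 _ (by
        rintro _ rfl; exact ⟨d, hf⟩))) p
      (sup_le hqp ((Ideal.span_singleton_le_iff_mem _).mpr hfp))
    exact ⟨q', Finset.mem_biUnion.mpr ⟨q, hq, (Set.Finite.mem_toFinset _).mpr hq'⟩, hle⟩

/-- If the closure of a horizontal point `p` has generic fibre of dimension at most one, then two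
homogeneous elements of the same degree suffice to cut out the empty set in its fibre over a
nonzero maximal ideal. -/
theorem exists_pair_forall_notMem [IsDomain R] [Ring.DimensionLEOne R] [IsNoetherianRing A]
    (m : Ideal R) [m.IsMaximal] (hm : m ≠ ⊥) (p : ProjectiveSpectrum 𝒜)
    (hp : p.asHomogeneousIdeal.toIdeal.comap (algebraMap R A) = ⊥)
    (hdim : ∀ q r : ProjectiveSpectrum 𝒜, p < q → q < r →
      r.asHomogeneousIdeal.toIdeal.comap (algebraMap R A) ≠ ⊥) :
    ∃ d, 0 < d ∧ ∃ f ∈ 𝒜 d, ∃ g ∈ 𝒜 d, ∀ x : ProjectiveSpectrum 𝒜, p ≤ x →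
      x.asHomogeneousIdeal.toIdeal.comap (algebraMap R A) = m →
      f ∉ x.asHomogeneousIdeal.toIdeal ∨ g ∉ x.asHomogeneousIdeal.toIdeal := by
  obtain ⟨d, hd, f, hf, T, hT, hfT⟩ := exists_cut 𝒜 m {p} (by
    intro q hq
    rw [Finset.mem_singleton.mp hq, Ideal.map_le_iff_le_comap, hp, le_bot_iff]
    exact hm)
  obtain ⟨e, he, g, hg, T', hT', hgT'⟩ := exists_cut 𝒜 m T fun q hq ↦ (hT q hq).1
  refine ⟨e * d, Nat.mul_pos he hd, f ^ e, by simpa using SetLike.pow_mem_graded e hf,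
    g ^ d, by simpa [mul_comm] using SetLike.pow_mem_graded d hg, fun x hpx hx ↦ ?_⟩
  by_contra! h
  obtain ⟨r, hr, hrx⟩ := hgT' x (x.isPrime.mem_of_pow_mem _ h.2)
    (hfT x (x.isPrime.mem_of_pow_mem _ h.1) ⟨p, Finset.mem_singleton_self _, hpx⟩)
  obtain ⟨hmr, q, hq, hqr⟩ := hT' r hr
  obtain ⟨-, p', hp', hpq⟩ := hT q hq
  rw [Finset.mem_singleton] at hp'
  subst hp'
  refine hdim q r hpq hqr ?_
  -- The contraction of `r` lies in `m` but does not contain it; in dimension at most one it must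
  -- vanish.
  by_contra hne
  have hrm : r.asHomogeneousIdeal.toIdeal.comap (algebraMap R A) ≤ m :=
    (Ideal.comap_mono hrx).trans hx.le
  have hmax : (r.asHomogeneousIdeal.toIdeal.comap (algebraMap R A)).IsMaximal :=
    Ring.DimensionLEOne.maximalOfPrime hne inferInstance
  rw [Ideal.map_le_iff_le_comap] at hmr
  exact hmr (hmax.eq_of_le (Ideal.IsMaximal.ne_top ‹_›) hrm).ge

end GradedRing

end ArithSurf

namespace ArithSurf

noncomputable section

open HomogeneousLocalization

/-! ### Morphisms to `Proj` from ring homomorphisms. -/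

section AwayEval

variable {σ : Type*} {A : Type u} [CommRing A] [SetLike σ A] [AddSubgroupClass σ A]
  (𝒜 : ℕ → σ) [GradedRing 𝒜] {B C : Type u} [CommRing B] [CommRing C]

/-- The ring homomorphism `(A_t)₀ → B` induced by `f : A → B` with `f t` invertible. -/
def awayEval (f : A →+* B) {t : A} (ht : IsUnit (f t)) : Away 𝒜 t →+* B :=
  (Localization.awayLift f t ht).comp (algebraMap (Away 𝒜 t) (Localization.Away t))

lemma awayEval_mk_mul (f : A →+* B) {t : A} (ht : IsUnit (f t)) {d : ℕ} (hd : t ∈ 𝒜 d) (n : ℕ)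
    (a : A) (ha : a ∈ 𝒜 (n • d)) :
    awayEval 𝒜 f ht (Away.mk 𝒜 hd n a ha) * f t ^ n = f a := by
  have h : (algebraMap (Away 𝒜 t) (Localization.Away t) (Away.mk 𝒜 hd n a ha)) *
      algebraMap A (Localization.Away t) (t ^ n) = algebraMap A _ a := by
    rw [HomogeneousLocalization.algebraMap_apply, Away.val_mk, Localization.mk_eq_mk']
    exact IsLocalization.mk'_spec _ _ _
  have h' := congr(Localization.awayLift f t ht $h)
  rw [map_mul] at h'
  simpa [awayEval, Localization.awayLift, IsLocalization.Away.lift_eq] using h'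

lemma awayEval_ext {f : A →+* B} {t : A} (ht : IsUnit (f t)) {d : ℕ} (hd : t ∈ 𝒜 d)
    {φ : Away 𝒜 t →+* B}
    (h : ∀ n a (ha : a ∈ 𝒜 (n • d)), φ (Away.mk 𝒜 hd n a ha) * f t ^ n = f a) :
    awayEval 𝒜 f ht = φ := by
  ext z
  obtain ⟨n, a, ha, rfl⟩ := Away.mk_surjective 𝒜 hd z
  refine (ht.pow n).mul_right_cancel ?_
  rw [awayEval_mk_mul, h]

lemma comp_awayEval (φ : B →+* C) (f : A →+* B) {t : A} (ht : IsUnit (f t))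
    (ht' : IsUnit (φ.comp f t)) {d : ℕ} (hd : t ∈ 𝒜 d) :
    φ.comp (awayEval 𝒜 f ht) = awayEval 𝒜 (φ.comp f) ht' := by
  refine (awayEval_ext 𝒜 ht' hd fun n a ha ↦ ?_).symm
  simp [← map_pow, ← map_mul, ← awayEval_mk_mul 𝒜 f ht hd n a ha]

/-- Fractions in `Away 𝒜 t` have degree zero, so the powers of `u` cancel. -/
lemma awayEval_eq_of_smul {f g : A →+* B} {t : A} (hf : IsUnit (f t)) (hg : IsUnit (g t)) {d : ℕ}
    (hd : t ∈ 𝒜 d) (u : B) (h : ∀ n, ∀ a ∈ 𝒜 n, f a = u ^ n * g a) :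
    awayEval 𝒜 f hf = awayEval 𝒜 g hg := by
  refine awayEval_ext 𝒜 hf hd fun n a ha ↦ ?_
  rw [h _ _ hd, h _ _ ha, ← awayEval_mk_mul 𝒜 g hg hd n a ha, smul_eq_mul]
  ring

lemma awayEval_comp_awayMap (f : A →+* B) {t s x : A} (ht : IsUnit (f t)) (hx : x = t * s)
    (hfx : IsUnit (f x)) {d e : ℕ} (hd : t ∈ 𝒜 d) (he : s ∈ 𝒜 e) :
    (awayEval 𝒜 f hfx).comp (awayMap 𝒜 he hx) = awayEval 𝒜 f ht := by
  refine (awayEval_ext 𝒜 ht hd fun n a ha ↦ ?_).symm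
  have hs : IsUnit (f s) := by
    rw [hx, map_mul] at hfx
    exact isUnit_of_mul_isUnit_right hfx
  refine (hs.pow n).mul_right_cancel ?_
  have h := awayEval_mk_mul 𝒜 f hfx (hx ▸ SetLike.mul_mem_graded hd he) n (a * s ^ n)
    (by rw [smul_add]; exact SetLike.mul_mem_graded ha (SetLike.pow_mem_graded n he))
  have hfts : f t * f s = f x := by rw [hx, map_mul]
  rw [RingHom.comp_apply, awayMap_mk, mul_assoc, ← mul_pow, hfts, h, map_mul, map_pow]

lemma awayEval_comp_fromZeroRingHom (f : A →+* B) {t : A} (ht : IsUnit (f t)) :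
    (awayEval 𝒜 f ht).comp (fromZeroRingHom 𝒜 (.powers t)) = f.comp (algebraMap (𝒜 0) A) := by
  ext a
  have : algebraMap (Away 𝒜 t) (Localization.Away t) (fromZeroRingHom 𝒜 (.powers t) a) =
      algebraMap A _ (a : A) := by
    rw [HomogeneousLocalization.algebraMap_apply]
    rfl
  simp only [awayEval, RingHom.comp_apply, this, Localization.awayLift,
    IsLocalization.Away.lift_eq]
  rfl

end AwayEval

section ToProj

variable {σ : Type*} {A : Type u} [CommRing A] [SetLike σ A] [AddSubgroupClass σ A]
  (𝒜 : ℕ → σ) [GradedRing 𝒜] {Y : Scheme.{u}}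

/-- The morphism from an open subscheme `W` to `Proj 𝒜` given by a ring homomorphism
`A → Γ(Y, W)` sending a homogeneous element of positive degree to a unit. -/
def toProjOfIsUnit {W : Y.Opens} (f : A →+* Γ(Y, W)) {t : A} (ht : IsUnit (f t)) {d : ℕ}
    (hd : t ∈ 𝒜 d) (h0 : 0 < d) : W.toScheme ⟶ Proj 𝒜 :=
  W.toSpecΓ ≫ Spec.map (CommRingCat.ofHom (awayEval 𝒜 f ht)) ≫ Proj.awayι 𝒜 t hd h0

lemma toProjOfIsUnit_eq_of_smul {W : Y.Opens} {f g : A →+* Γ(Y, W)} {t : A} (hf : IsUnit (f t))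
    (hg : IsUnit (g t)) {d : ℕ} (hd : t ∈ 𝒜 d) (h0 : 0 < d) (u : Γ(Y, W))
    (h : ∀ n, ∀ a ∈ 𝒜 n, f a = u ^ n * g a) :
    toProjOfIsUnit 𝒜 f hf hd h0 = toProjOfIsUnit 𝒜 g hg hd h0 := by
  rw [toProjOfIsUnit, toProjOfIsUnit, awayEval_eq_of_smul 𝒜 hf hg hd u h]

lemma homOfLE_toProjOfIsUnit {V W : Y.Opens} (h : V ≤ W) (f : A →+* Γ(Y, W)) {t : A}
    (ht : IsUnit (f t)) {d : ℕ} (hd : t ∈ 𝒜 d) (h0 : 0 < d) :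
    Y.homOfLE h ≫ toProjOfIsUnit 𝒜 f ht hd h0 =
      toProjOfIsUnit 𝒜 ((Y.presheaf.map (homOfLE h).op).hom.comp f)
        (t := t) (ht.map (Y.presheaf.map (homOfLE h).op).hom) hd h0 := by
  rw [toProjOfIsUnit, toProjOfIsUnit, ← Scheme.Opens.toSpecΓ_SpecMap_presheaf_map_assoc _ _ h,
    ← comp_awayEval 𝒜 _ f ht _ hd, CommRingCat.ofHom_comp, Spec.map_comp_assoc]
  rfl

lemma toProjOfIsUnit_mul {W : Y.Opens} (f : A →+* Γ(Y, W)) {t s x : A} (ht : IsUnit (f t))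
    (hx : x = t * s) (hfx : IsUnit (f x)) {d e c : ℕ} (hd : t ∈ 𝒜 d) (he : s ∈ 𝒜 e)
    (h0 : 0 < d) (hc : x ∈ 𝒜 c) (hc0 : 0 < c) (hcde : c = d + e) :
    toProjOfIsUnit 𝒜 f hfx hc hc0 = toProjOfIsUnit 𝒜 f ht hd h0 := by
  subst hcde
  rw [toProjOfIsUnit, toProjOfIsUnit, ← awayEval_comp_awayMap 𝒜 f ht hx hfx hd he,
    CommRingCat.ofHom_comp, Spec.map_comp_assoc, Proj.SpecMap_awayMap_awayι]

lemma toProjOfIsUnit_eq {W : Y.Opens} (f : A →+* Γ(Y, W)) {t s : A} (ht : IsUnit (f t))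
    (hs : IsUnit (f s)) {d e : ℕ} (hd : t ∈ 𝒜 d) (he : s ∈ 𝒜 e) (h0 : 0 < d) (he0 : 0 < e) :
    toProjOfIsUnit 𝒜 f ht hd h0 = toProjOfIsUnit 𝒜 f hs he he0 := by
  have hts : IsUnit (f (t * s)) := by rw [map_mul]; exact ht.mul hs
  have hm := SetLike.mul_mem_graded hd he
  rw [← toProjOfIsUnit_mul 𝒜 f ht rfl hts hd he h0 hm (by omega) rfl,
    ← toProjOfIsUnit_mul 𝒜 f hs (mul_comm t s) hts he hd he0 hm (by omega) (add_comm _ _)]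

lemma toProjOfIsUnit_preimage_basicOpen {W : Y.Opens} (f : A →+* Γ(Y, W)) {t s : A}
    (ht : IsUnit (f t)) {d e : ℕ} (hd : t ∈ 𝒜 d) (he : s ∈ 𝒜 e) (h0 : 0 < d) (he0 : 0 < e) :
    toProjOfIsUnit 𝒜 f ht hd h0 ⁻¹ᵁ Proj.basicOpen 𝒜 s = W.ι ⁻¹ᵁ Y.basicOpen (f s) := by
  have h1 : toProjOfIsUnit 𝒜 f ht hd h0 ⁻¹ᵁ Proj.basicOpen 𝒜 s = W.toSpecΓ ⁻¹ᵁ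
      (PrimeSpectrum.basicOpen (awayEval 𝒜 f ht (Away.isLocalizationElem hd he))) := by
    rw [toProjOfIsUnit, Scheme.Hom.comp_preimage, Scheme.Hom.comp_preimage,
      Proj.awayι_preimage_basicOpen 𝒜 hd h0 he he0]
    rfl
  rw [h1, Scheme.Opens.toSpecΓ_preimage_basicOpen]
  congr 1
  -- The localization element is `s ^ d / t ^ e`; its value times the unit `f t ^ e` is `f s ^ d`,
  -- so both have the same basic open.
  have h2 := awayEval_mk_mul 𝒜 f ht hd e (s ^ d) (by
    convert SetLike.pow_mem_graded d he using 2; exact mul_comm _ _)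
  have h3 := congr(Y.basicOpen $h2)
  rw [Scheme.basicOpen_mul, Scheme.basicOpen_of_isUnit _ (ht.pow e), map_pow,
    Scheme.basicOpen_pow _ _ h0] at h3
  rw [← h3, inf_eq_left.mpr (Scheme.basicOpen_le _ _)]

lemma toProjOfIsUnit_toSpecZero {W : Y.Opens} (f : A →+* Γ(Y, W)) {t : A}
    (ht : IsUnit (f t)) {d : ℕ} (hd : t ∈ 𝒜 d) (h0 : 0 < d) :
    toProjOfIsUnit 𝒜 f ht hd h0 ≫ Proj.toSpecZero 𝒜 =
      W.toSpecΓ ≫ Spec.map (CommRingCat.ofHom (f.comp (algebraMap (𝒜 0) A))) := by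
  rw [toProjOfIsUnit, Category.assoc, Category.assoc, Proj.awayι_toSpecZero, ← Spec.map_comp,
    ← CommRingCat.ofHom_comp, awayEval_comp_fromZeroRingHom]

/-- Morphisms to `Proj 𝒜` given on an open cover by ring homomorphisms which agree up to
rescaling glue. -/
theorem exists_glue_toProj {ι : Type*} (W : ι → Y.Opens) (hW : TopologicalSpace.IsOpenCover W)
    (f : ∀ i, A →+* Γ(Y, W i)) (t : ι → A) (ht : ∀ i, IsUnit (f i (t i))) (d : ι → ℕ)
    (hd : ∀ i, t i ∈ 𝒜 (d i)) (h0 : ∀ i, 0 < d i)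
    (hf : ∀ i j, ∃ u : Γ(Y, W i ⊓ W j), IsUnit u ∧ ∀ n, ∀ a ∈ 𝒜 n,
      Y.presheaf.map (homOfLE (inf_le_left : W i ⊓ W j ≤ W i)).op (f i a) =
        u ^ n * Y.presheaf.map (homOfLE (inf_le_right : W i ⊓ W j ≤ W j)).op (f j a)) :
    ∃ ρ : Y ⟶ Proj 𝒜, ∀ i, (W i).ι ≫ ρ = toProjOfIsUnit 𝒜 (f i) (ht i) (hd i) (h0 i) := by
  suffices key : ∀ i j : ι, Limits.pullback.fst (W i).ι (W j).ι ≫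
      toProjOfIsUnit 𝒜 (f i) (ht i) (hd i) (h0 i) = Limits.pullback.snd (W i).ι (W j).ι ≫
      toProjOfIsUnit 𝒜 (f j) (ht j) (hd j) (h0 j) by
    exact ⟨(Y.openCoverOfIsOpenCover W hW).glueMorphisms
      (fun i ↦ toProjOfIsUnit 𝒜 (f i) (ht i) (hd i) (h0 i)) key,
      fun i ↦ (Y.openCoverOfIsOpenCover W hW).ι_glueMorphisms _ _ i⟩
  intro i j
  obtain ⟨u, hu, h⟩ := hf i j
  let e := (isPullback_opens_inf (W i) (W j)).isoPullback
  rw [← cancel_epi e.hom]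
  have h1 : e.hom ≫ Limits.pullback.fst (W i).ι (W j).ι = Y.homOfLE inf_le_left :=
    (isPullback_opens_inf (W i) (W j)).isoPullback_hom_fst
  have h2 : e.hom ≫ Limits.pullback.snd (W i).ι (W j).ι = Y.homOfLE inf_le_right :=
    (isPullback_opens_inf (W i) (W j)).isoPullback_hom_snd
  rw [reassoc_of% h1, reassoc_of% h2, homOfLE_toProjOfIsUnit, homOfLE_toProjOfIsUnit]
  have hj := (ht j).map (Y.presheaf.map (homOfLE (inf_le_right : W i ⊓ W j ≤ W j)).op).hom
  -- On the overlap `f i` also makes `t j` invertible, so both morphisms can be written with the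
  -- denominator `t j`.
  have hij : IsUnit (((Y.presheaf.map (homOfLE (inf_le_left : W i ⊓ W j ≤ W i)).op).hom.comp
      (f i)) (t j)) := by
    rw [RingHom.comp_apply]
    erw [h _ _ (hd j)]
    exact (hu.pow _).mul hj
  rw [toProjOfIsUnit_eq 𝒜 _ _ hij _ (hd j) _ (h0 j)]
  exact toProjOfIsUnit_eq_of_smul 𝒜 _ _ _ _ u h

end ToProj

end

end ArithSurf

namespace ArithSurf

noncomputable section

attribute [local instance] MvPolynomial.gradedAlgebra

open HomogeneousLocalization

/-! ### Maps to projective space from homogeneous elements. -/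

section Ratio

variable {σ : Type*} {A : Type u} [CommRing A] [SetLike σ A] [AddSubgroupClass σ A]
  (𝒜 : ℕ → σ) [GradedRing 𝒜] {d : ℕ} {f g k : A}

/-- The section `g / f` of the structure sheaf of `Proj 𝒜` over `D₊(f)`, for homogeneous elements
of the same degree. -/
def ratio (hf : f ∈ 𝒜 d) (hg : g ∈ 𝒜 d) : Γ(Proj 𝒜, Proj.basicOpen 𝒜 f) :=
  (Proj.awayToSection 𝒜 f).hom (Away.mk 𝒜 hf 1 g (by simpa using hg))

lemma ratio_self (hf : f ∈ 𝒜 d) : ratio 𝒜 hf hf = 1 := by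
  have : Away.mk 𝒜 hf 1 f (by simpa using hf) = 1 := by
    ext
    simp [Away.val_mk]
  rw [ratio, this, map_one]

lemma basicOpen_ratio (hf : f ∈ 𝒜 d) (hg : g ∈ 𝒜 d) (hd : 0 < d) :
    (Proj 𝒜).basicOpen (ratio 𝒜 hf hg) = Proj.basicOpen 𝒜 f ⊓ Proj.basicOpen 𝒜 g := by
  have h1 : Away.isLocalizationElem hf hg = (Away.mk 𝒜 hf 1 g (by simpa using hg)) ^ d := by
    ext
    simp [Away.val_mk, Localization.mk_pow]
  have h2 : (Proj.basicOpen 𝒜 f).ι ⁻¹ᵁ Proj.basicOpen 𝒜 g =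
      (Proj.basicOpen 𝒜 f).ι ⁻¹ᵁ (Proj 𝒜).basicOpen (ratio 𝒜 hf hg) := by
    have : (Proj.basicOpen 𝒜 f).ι = Proj.basicOpenToSpec 𝒜 f ≫ Proj.awayι 𝒜 f hf hd := by
      rw [← Proj.basicOpenIsoSpec_inv_ι, ← Proj.basicOpenIsoSpec_hom 𝒜 f hf hd,
        Iso.hom_inv_id_assoc]
    conv_lhs => rw [this]
    rw [Scheme.Hom.comp_preimage, Proj.awayι_preimage_basicOpen 𝒜 hf hd hg hd, h1,
      PrimeSpectrum.basicOpen_pow _ _ hd, ← Scheme.Opens.toSpecΓ_preimage_basicOpen]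
    rfl
  have h3 := congr((Proj.basicOpen 𝒜 f).ι ''ᵁ $h2)
  rw [Scheme.Hom.image_preimage_eq_opensRange_inf, Scheme.Hom.image_preimage_eq_opensRange_inf,
    Scheme.Opens.opensRange_ι] at h3
  rw [h3, inf_eq_right.mpr (Scheme.basicOpen_le _ _)]

lemma ratio_mul_ratio (hf : f ∈ 𝒜 d) (hg : g ∈ 𝒜 d) (hk : k ∈ 𝒜 d) :
    (Proj 𝒜).presheaf.map (homOfLE (Proj.basicOpen_mono 𝒜 f (f * g) ⟨g, rfl⟩)).op (ratio 𝒜 hf hk) =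
    (Proj 𝒜).presheaf.map (homOfLE (Proj.basicOpen_mono 𝒜 f (f * g) ⟨g, rfl⟩)).op (ratio 𝒜 hf hg) *
    (Proj 𝒜).presheaf.map (homOfLE (Proj.basicOpen_mono 𝒜 g (f * g) ⟨f, mul_comm f g⟩)).op
      (ratio 𝒜 hg hk) := by
  have h1 := fun z ↦ congr($(Proj.awayMap_awayToSection 𝒜 (f := f) hg (x := f * g) rfl).hom z)
  have h2 := fun z ↦ congr($(Proj.awayMap_awayToSection 𝒜 (f := g) hf (x := f * g)
    (mul_comm f g)).hom z)
  simp only [CommRingCat.hom_comp, RingHom.comp_apply, CommRingCat.hom_ofHom] at h1 h2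
  erw [ratio, ratio, ratio, ← h1, ← h1, ← h2]
  rw [← map_mul]
  congr 1
  ext
  simp only [awayMap_mk, Away.val_mk, HomogeneousLocalization.val_mul, Localization.mk_mul]
  rw [Localization.mk_eq_mk_iff, Localization.r_iff_exists]
  refine ⟨1, ?_⟩
  simp
  ring

end Ratio

lemma eval₂_smul_of_isHomogeneous {σ Γ B : Type*} [CommRing Γ] [CommRing B] (h : Γ →+* B) (u : B) (x : σ → B) {n : ℕ}
    {a : MvPolynomial σ Γ} (ha : a.IsHomogeneous n) :
    a.eval₂ h (fun i ↦ u * x i) = u ^ n * a.eval₂ h x := by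
  rw [MvPolynomial.eval₂_eq, MvPolynomial.eval₂_eq, Finset.mul_sum]
  refine Finset.sum_congr rfl fun s hs ↦ ?_
  have : ∑ i ∈ s.support, s i = n :=
    (DFunLike.congr_fun Finsupp.degree_eq_weight_one s).trans
      (ha (MvPolynomial.mem_support_iff.mp hs))
  simp_rw [mul_pow]
  rw [Finset.prod_mul_distrib, Finset.prod_pow_eq_pow_sum, this]
  ring

/-- Homogeneous elements `F₀, …, Fₙ` of the same positive degree without common zero on `Y`
define a morphism from `Y` to projective `n`-space. -/
theorem exists_toProjectiveSpace {σ : Type*} {A : Type u} [CommRing A] [SetLike σ A]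
    [AddSubgroupClass σ A] (𝒜 : ℕ → σ) [GradedRing 𝒜] {Y : Scheme.{u}} (j : Y ⟶ Proj 𝒜)
    {Γ : Type u} [CommRing Γ] (h : Γ →+* Γ(Y, ⊤)) {n d : ℕ} (hd : 0 < d) (F : Fin (n + 1) → A)
    (hF : ∀ i, F i ∈ 𝒜 d)
    (hcov : TopologicalSpace.IsOpenCover fun i ↦ j ⁻¹ᵁ Proj.basicOpen 𝒜 (F i)) :
    ∃ ρ : Y ⟶ projectiveSpace n Γ,
      ρ ≫ projectiveSpaceToSpec n Γ = Y.toSpecΓ ≫ Spec.map (CommRingCat.ofHom h) ∧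
      ∀ i, ρ ⁻¹ᵁ Proj.basicOpen (grading n Γ) (MvPolynomial.X i) =
        j ⁻¹ᵁ Proj.basicOpen 𝒜 (F i) := by
  let W (i) : Y.Opens := j ⁻¹ᵁ Proj.basicOpen 𝒜 (F i)
  let s (i k) : Γ(Y, W i) := (j.app (Proj.basicOpen 𝒜 (F i))).hom (ratio 𝒜 (hF i) (hF k))
  let res (V : Y.Opens) : Γ(Y, ⊤) →+* Γ(Y, V) := (Y.presheaf.map (homOfLE le_top).op).hom
  -- Dehomogenisation on the `i`-th chart: `X k` goes to `F k / F i`.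
  let φ (i) : MvPolynomial (Fin (n + 1)) Γ →+* Γ(Y, W i) :=
    MvPolynomial.eval₂Hom ((res (W i)).comp h) (s i)
  have hφX (i k) : φ i (.X k) = s i k := MvPolynomial.eval₂_X _ _ _
  have hsself (i) : s i i = 1 := by
    simp only [s, ratio_self, map_one]
  have hscocycle (i k l) :
      Y.presheaf.map (homOfLE (inf_le_left : W i ⊓ W k ≤ W i)).op (s i l) =
      Y.presheaf.map (homOfLE (inf_le_left : W i ⊓ W k ≤ W i)).op (s i k) *
      Y.presheaf.map (homOfLE (inf_le_right : W i ⊓ W k ≤ W k)).op (s k l) := by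
    have hle : W i ⊓ W k ≤ j ⁻¹ᵁ Proj.basicOpen 𝒜 (F i * F k) := by
      rw [Proj.basicOpen_mul]
      exact le_rfl
    have := congr(j.appLE _ _ hle $(ratio_mul_ratio 𝒜 (hF i) (hF k) (hF l)))
    rw [map_mul] at this
    simp only [← ConcreteCategory.comp_apply, Scheme.Hom.map_appLE] at this
    exact this
  have hsbasic (i k) : Y.basicOpen (s i k) = W i ⊓ W k := by
    have := Scheme.preimage_basicOpen j (ratio 𝒜 (hF i) (hF k))
    rw [basicOpen_ratio 𝒜 _ _ hd] at this
    exact this.symm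
  have hXmem (i) : (MvPolynomial.X i : MvPolynomial (Fin (n + 1)) Γ) ∈ grading n Γ 1 :=
    MvPolynomial.isHomogeneous_X _ _
  have hunit (i) : IsUnit (φ i (.X i)) := by
    rw [hφX, hsself]
    exact isUnit_one
  have hφ (i k : Fin (n + 1)) : ∃ u : Γ(Y, W i ⊓ W k), IsUnit u ∧ ∀ m, ∀ a ∈ grading n Γ m,
      Y.presheaf.map (homOfLE (inf_le_left : W i ⊓ W k ≤ W i)).op (φ i a) =
        u ^ m * Y.presheaf.map (homOfLE (inf_le_right : W i ⊓ W k ≤ W k)).op (φ k a) := by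
    -- The scaling factor is `F k / F i`, whose inverse is `F i / F k` by the cocycle relation.
    refine ⟨Y.presheaf.map (homOfLE (inf_le_left : W i ⊓ W k ≤ W i)).op (s i k), ?_, ?_⟩
    · refine IsUnit.of_mul_eq_one _ ((hscocycle i k i).symm.trans ?_)
      rw [hsself, map_one]
    · intro m a ha
      have hc (V V' : Y.Opens) (hV : V' ≤ V) :
          (Y.presheaf.map (homOfLE hV).op).hom.comp (res V) = res V' := by
        rw [← CommRingCat.hom_comp, ← Functor.map_comp]
        rfl
      have h1 := MvPolynomial.hom_eval₂ a ((res (W i)).comp h)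
        (Y.presheaf.map (homOfLE (inf_le_left : W i ⊓ W k ≤ W i)).op).hom (s i)
      have h2 := MvPolynomial.hom_eval₂ a ((res (W k)).comp h)
        (Y.presheaf.map (homOfLE (inf_le_right : W i ⊓ W k ≤ W k)).op).hom (s k)
      rw [← RingHom.comp_assoc, hc] at h1 h2
      refine h1.trans (Eq.trans ?_ congr(_ * $(h2.symm)))
      rw [← eval₂_smul_of_isHomogeneous _ _ _ ha]
      exact congr(MvPolynomial.eval₂ _ $(funext fun l ↦ hscocycle i k l) a)
  obtain ⟨ρ, hρ⟩ := exists_glue_toProj (grading n Γ) W hcov φ (fun i ↦ .X i) hunit (fun _ ↦ 1)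
    hXmem (fun _ ↦ one_pos) hφ
  refine ⟨ρ, ?_, fun k ↦ ?_⟩
  · suffices h : ∀ i, (W i).ι ≫ ρ ≫ projectiveSpaceToSpec n Γ =
        (W i).ι ≫ Y.toSpecΓ ≫ Spec.map (CommRingCat.ofHom h) from
      (Y.openCoverOfIsOpenCover W hcov).hom_ext _ _ h
    intro i
    change (W i).ι ≫ (show Y ⟶ Proj (grading n Γ) from ρ) ≫ Proj.toSpecZero (grading n Γ) ≫
      Spec.map (CommRingCat.ofHom (algebraMap Γ (grading n Γ 0))) = _
    rw [reassoc_of% hρ i, ← Category.assoc, toProjOfIsUnit_toSpecZero, Category.assoc, ← Spec.map_comp, ← CommRingCat.ofHom_comp,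
      ← Scheme.Opens.toSpecΓ_SpecMap_presheaf_map_top_assoc, ← Spec.map_comp]
    congr 2
    ext x
    exact MvPolynomial.eval₂_C _ _ _
  · refine TopologicalSpace.Opens.ext (Set.ext fun y ↦ ?_)
    obtain ⟨i, hi⟩ := hcov.exists_mem y
    have h1 := toProjOfIsUnit_preimage_basicOpen (grading n Γ) (φ i) (hunit i) (hXmem i) (hXmem k)
      one_pos one_pos
    rw [← hρ i, hφX, hsbasic, Scheme.Hom.comp_preimage] at h1
    have h2 := congr((⟨y, hi⟩ : (W i).toScheme) ∈ $h1)
    have h3 : y ∈ ρ ⁻¹ᵁ Proj.basicOpen (grading n Γ) (.X k) ↔ y ∈ W i ⊓ W k := iff_of_eq h2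
    exact h3.trans ⟨fun h ↦ h.2, fun h ↦ ⟨hi, h⟩⟩

end

end ArithSurf

namespace ArithSurf

noncomputable section

attribute [local instance] MvPolynomial.gradedAlgebra

open HomogeneousLocalization

/-! ### From the generic fibre to a finite morphism. -/

lemma toSpecZero_apply_asIdeal {A : Type u} {σ : Type*} [CommRing A] [SetLike σ A]
    [AddSubgroupClass σ A] (𝒜 : ℕ → σ) [GradedRing 𝒜] {d : ℕ} (hd : 0 < d) {f : A} (hf : f ∈ 𝒜 d)
    (p : Proj 𝒜) (hfp : f ∉ p.asHomogeneousIdeal) :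
    (Proj.toSpecZero 𝒜 p).asIdeal =
      p.asHomogeneousIdeal.toIdeal.comap (algebraMap (𝒜 0) A) := by
  ext r
  have hp : p ∈ (Proj.awayι 𝒜 f hf hd).opensRange := by
    rw [Proj.opensRange_awayι]
    exact hfp
  obtain ⟨q, rfl⟩ := hp
  -- Multiplying by `f` gives `r` positive degree, as the chart formula for basic opens requires;
  -- since `f ∉ p`, membership in `p` is unaffected.
  have hrf : (r : A) * f ∈ 𝒜 d := by simpa using SetLike.mul_mem_graded r.2 hf
  have h1 : q ∈ Proj.awayι 𝒜 f hf hd ⁻¹ᵁ Proj.basicOpen 𝒜 (r * f) ↔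
      Away.isLocalizationElem hf hrf ∉ q.asIdeal := by
    rw [Proj.awayι_preimage_basicOpen 𝒜 hf hd hrf hd]
    rfl
  have h2 : Away.isLocalizationElem hf hrf = (fromZeroRingHom 𝒜 (.powers f) r) ^ d := by
    ext
    rw [HomogeneousLocalization.val_pow, Away.val_mk]
    change _ = (Localization.mk _ _) ^ d
    rw [Localization.mk_pow, Localization.mk_eq_mk_iff, Localization.r_iff_exists]
    refine ⟨1, ?_⟩
    simp
    ring
  have h3 : q ∈ Proj.awayι 𝒜 f hf hd ⁻¹ᵁ Proj.basicOpen 𝒜 (r * f) ↔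
      (r : A) ∉ (Proj.awayι 𝒜 f hf hd q).asHomogeneousIdeal.toIdeal := by
    change (r : A) * f ∉ (Proj.awayι 𝒜 f hf hd q).asHomogeneousIdeal.toIdeal ↔ _
    rw [(Proj.awayι 𝒜 f hf hd q).isPrime.mul_mem_iff_mem_or_mem, not_or]
    exact and_iff_left hfp
  rw [← Scheme.Hom.comp_apply, Proj.awayι_toSpecZero]
  change fromZeroRingHom 𝒜 (.powers f) r ∈ q.asIdeal ↔
    (r : A) ∈ (Proj.awayι 𝒜 f hf hd q).asHomogeneousIdeal.toIdeal
  rw [← not_iff_not, ← h3, h1, h2, q.isPrime.pow_mem_iff_mem d hd]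

lemma projectiveSpaceToSpec_apply_asIdeal (n : ℕ) (R : Type u) [CommRing R]
    (p : projectiveSpace n R) :
    (projectiveSpaceToSpec n R p).asIdeal =
      (ProjectiveSpectrum.asHomogeneousIdeal (𝒜 := grading n R) p).toIdeal.comap
        (algebraMap R (MvPolynomial (Fin (n + 1)) R)) := by
  obtain ⟨d, hd, f, hf, hfp⟩ := exists_homogeneous_notMem (grading n R) p
  have h := toSpecZero_apply_asIdeal (grading n R) hd hf p hfp
  have : (projectiveSpaceToSpec n R p).asIdeal =
      (Proj.toSpecZero (grading n R) p).asIdeal.comap (algebraMap R (grading n R 0)) := rfl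
  rw [this, h, Ideal.comap_comap]
  rfl

lemma algebraMap_grading_zero_surjective (n : ℕ) (R : Type u) [CommRing R] :
    Function.Surjective (algebraMap R (grading n R 0)) := by
  rintro ⟨a, ha⟩
  rw [grading, MvPolynomial.homogeneousSubmodule_zero, Submodule.mem_one] at ha
  obtain ⟨r, rfl⟩ := ha
  exact ⟨r, rfl⟩

instance isProper_projectiveSpaceToSpec (n : ℕ) (R : Type u) [CommRing R] :
    IsProper (projectiveSpaceToSpec n R) := by
  have : IsScalarTower R (grading n R 0) (MvPolynomial (Fin (n + 1)) R) :=
    .of_algebraMap_eq (R := R) (S := grading n R 0) (A := MvPolynomial (Fin (n + 1)) R) fun _ ↦ rfl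
  have : Algebra.FiniteType (grading n R 0) (MvPolynomial (Fin (n + 1)) R) :=
    .of_restrictScalars_finiteType R _ _
  have : IsClosedImmersion (Spec.map (CommRingCat.ofHom (algebraMap R (grading n R 0)))) :=
    IsClosedImmersion.spec_of_surjective _ (algebraMap_grading_zero_surjective n R)
  exact MorphismProperty.comp_mem @IsProper (Proj.toSpecZero (grading n R)) _ inferInstance
    inferInstance

lemma projectiveSpace_le_iff_specializes {n : ℕ} {R : Type u} [CommRing R]
    (p q : ProjectiveSpectrum (grading n R)) :
    p ≤ q ↔ (show projectiveSpace n R from p) ⤳ (show projectiveSpace n R from q) := by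
  rw [ProjectiveSpectrum.le_iff_mem_closure, specializes_iff_mem_closure]
  rfl

lemma not_lt_lt_of_topologicalKrullDim_le_one {T : Type*} [TopologicalSpace T]
    (h : topologicalKrullDim T ≤ 1) {x y z : T} (hxy : x ⤳ y) (hyz : y ⤳ z) :
    y ⤳ x ∨ z ⤳ y := by
  by_contra! hn
  let c (t : T) : TopologicalSpace.IrreducibleCloseds T :=
    ⟨closure {t}, isIrreducible_singleton.closure, isClosed_closure⟩
  have hlt {a b : T} (hab : a ⤳ b) (hba : ¬ b ⤳ a) : c b < c a := by
    refine lt_of_le_not_ge (specializes_iff_closure_subset.mp hab) fun h' ↦ hba ?_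
    exact specializes_iff_closure_subset.mpr h'
  let l : LTSeries (TopologicalSpace.IrreducibleCloseds T) :=
    ((RelSeries.singleton _ (c x)).cons (c y) (hlt hxy hn.1)).cons (c z) (by exact hlt hyz hn.2)
  have h2 : ((2 : ℕ) : WithBot ℕ∞) ≤ 1 := (Order.LTSeries.length_le_krullDim l).trans h
  exact absurd (by exact_mod_cast h2) (by norm_num : ¬ (2 : ℕ) ≤ 1)

/-- If the generic fibre of a flat `π` is irreducible of dimension at most one, two homogeneous
elements of the same degree have no common zero on the fibre of `X ⊆ ℙⁿ` over a closed point. -/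
theorem exists_pair_of_isMaximal {R : Type u} [CommRing R] [IsDomain R] [Ring.DimensionLEOne R]
    [IsNoetherianRing R] {X : Scheme.{u}} (π : X ⟶ Spec (.of R)) [Flat π]
    [IrreducibleSpace (π.fiber (genericPoint (Spec (.of R))))]
    (hdim : topologicalKrullDim (π.fiber (genericPoint (Spec (.of R)))) ≤ 1)
    {n : ℕ} (i : X ⟶ projectiveSpace n R) [IsClosedImmersion i]
    (hi : i ≫ projectiveSpaceToSpec n R = π) (m : Spec (.of R)) [m.asIdeal.IsMaximal]
    (hm : m.asIdeal ≠ ⊥) :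
    ∃ d, 0 < d ∧ ∃ f ∈ grading n R d, ∃ g ∈ grading n R d, ∀ x : X, π x = m →
      x ∈ i ⁻¹ᵁ Proj.basicOpen (grading n R) f ∨ x ∈ i ⁻¹ᵁ Proj.basicOpen (grading n R) g := by
  let η := genericPoint (Spec (.of R))
  have hη : η.asIdeal = ⊥ := by
    change (genericPoint (Spec (.of R))).asIdeal = ⊥
    rw [genericPoint_eq_bot_of_affine]
    rfl
  have hιπ (y : π.fiber η) : π (π.fiberι η y) = η := by
    have : π.fiberι η y ∈ Set.range (π.fiberι η) := ⟨y, rfl⟩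
    rwa [π.range_fiberι η] at this
  have hιsurj (x : X) (hx : π x = η) : ∃ y, π.fiberι η y = x := by
    have : x ∈ Set.range (π.fiberι η) := by
      rw [π.range_fiberι η]
      exact hx
    exact this
  have hpt (x : X) : (π x).asIdeal =
      (ProjectiveSpectrum.asHomogeneousIdeal (𝒜 := grading n R) (i x)).toIdeal.comap
        (algebraMap R (MvPolynomial (Fin (n + 1)) R)) := by
    rw [← projectiveSpaceToSpec_apply_asIdeal, ← Scheme.Hom.comp_apply, hi]
  let ξ : π.fiber η := genericPoint (π.fiber η)
  have hξ (y : π.fiber η) : ξ ⤳ y := genericPoint_specializes y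
  let p : ProjectiveSpectrum (grading n R) := i (π.fiberι η ξ)
  have hind : Topology.IsInducing (fun y ↦ i (π.fiberι η y)) :=
    i.isClosedEmbedding.isInducing.comp (π.fiberι η).isEmbedding.isInducing
  -- The image of `X` is closed and contains `p`, so it contains every specialization of `p`.
  have hlift (q : ProjectiveSpectrum (grading n R)) (hpq : p ≤ q)
      (hq : q.asHomogeneousIdeal.toIdeal.comap (algebraMap R _) = ⊥) :
      ∃ y : π.fiber η, i (π.fiberι η y) = q := by
    rw [projectiveSpace_le_iff_specializes] at hpq
    obtain ⟨x, hx⟩ : (show projectiveSpace n R from q) ∈ Set.range i :=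
      hpq.mem_closed i.isClosedEmbedding.isClosed_range ⟨_, rfl⟩
    obtain ⟨y, rfl⟩ := hιsurj x (PrimeSpectrum.ext (by rw [hpt, hx, hη]; exact hq))
    exact ⟨y, hx⟩
  obtain ⟨d, hd, f, hf, g, hg, h⟩ := exists_pair_forall_notMem (grading n R) m.asIdeal hm p
    (by rw [← hpt, hιπ, hη]) (by
      intro q r hpq hqr hr
      obtain ⟨y, rfl⟩ := hlift q hpq.le
        (le_bot_iff.mp ((Ideal.comap_mono hqr.le).trans hr.le))
      obtain ⟨z, rfl⟩ := hlift r (hpq.trans hqr).le hr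
      have hyz : y ⤳ z := hind.specializes_iff.mp ((projectiveSpace_le_iff_specializes _ _).mp hqr.le)
      rcases not_lt_lt_of_topologicalKrullDim_le_one hdim (hξ y) hyz with h | h
      · exact hpq.not_ge ((projectiveSpace_le_iff_specializes _ _).mpr (hind.specializes_iff.mpr h))
      · exact hqr.not_ge ((projectiveSpace_le_iff_specializes _ _).mpr (hind.specializes_iff.mpr h)))
  refine ⟨d, hd, f, hf, g, hg, fun x hx ↦ h (i x) ?_ (by rw [← hpt, hx])⟩
  -- Flatness lets generizations lift: `x` specializes from a point of the generic fibre, hence from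
  -- `ξ`.
  obtain ⟨x', hx'x, hx'⟩ := Flat.generalizingMap π (genericPoint_specializes (π x))
  obtain ⟨y, rfl⟩ := hιsurj x' hx'
  refine (projectiveSpace_le_iff_specializes _ _).mpr ?_
  exact (((hξ y).map (π.fiberι η).continuous).trans hx'x).map i.continuous

/-- The standard charts cover: a homogeneous prime containing all variables contains every form of
positive degree. -/
lemma isAffineHom_of_preimage_basicOpen_X {n : ℕ} {Γ : Type u} [CommRing Γ] {Y : Scheme.{u}}
    (ρ : Y ⟶ projectiveSpace n Γ)
    (h : ∀ k, IsAffineOpen (ρ ⁻¹ᵁ Proj.basicOpen (grading n Γ) (MvPolynomial.X k))) :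
    IsAffineHom ρ := by
  refine isAffineHom_of_forall_exists_isAffineOpen _ fun x ↦ ?_
  by_contra! hx
  have hX (k) : (MvPolynomial.X k : MvPolynomial (Fin (n + 1)) Γ) ∈ grading n Γ 1 :=
    MvPolynomial.isHomogeneous_X _ _
  have hmem (k) : (MvPolynomial.X k : MvPolynomial (Fin (n + 1)) Γ) ∈
      (ProjectiveSpectrum.asHomogeneousIdeal (𝒜 := grading n Γ) x).toIdeal := by
    by_contra hk
    exact hx _ hk (Proj.isAffineOpen_basicOpen (grading n Γ) _ (hX k) one_pos) (h k)
  obtain ⟨d, hd, f, hf, hfx⟩ := exists_homogeneous_notMem (grading n Γ) x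
  refine hfx (Ideal.span_le.mpr (Set.range_subset_iff.mpr hmem) ?_)
  rw [← Set.image_univ, MvPolynomial.mem_ideal_span_X_image]
  intro c hc
  by_contra! h0
  have hc0 : c = 0 := Finsupp.ext fun k ↦ h0 k (Set.mem_univ k)
  have := hf (MvPolynomial.mem_support_iff.mp hc)
  rw [hc0, map_zero] at this
  exact hd.ne this

theorem exists_finite_of_isMaximal {R : Type u} [CommRing R] [IsDomain R] [Ring.DimensionLEOne R]
    [IsNoetherianRing R] {X : Scheme.{u}} (π : X ⟶ Spec (.of R)) [Flat π]
    [IrreducibleSpace (π.fiber (genericPoint (Spec (.of R))))]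
    (hdim : topologicalKrullDim (π.fiber (genericPoint (Spec (.of R)))) ≤ 1)
    (hπ : IsProjective π) (m : Spec (.of R)) [m.asIdeal.IsMaximal] (hm : m.asIdeal ≠ ⊥) :
    ∃ (U : (Spec (.of R)).Opens) (hU : IsAffineOpen U), m ∈ U ∧
      ∃ ρ : (π ⁻¹ᵁ U).toScheme ⟶ projectiveSpace 1 Γ(Spec (.of R), U),
        ρ ≫ projectiveSpaceToOpen 1 hU = π ∣_ U ∧ IsFinite ρ := by
  obtain ⟨n, i, _, hi⟩ := hπ
  obtain ⟨d, hd, f, hf, g, hg, hfg⟩ := exists_pair_of_isMaximal π hdim i hi m hm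
  have : IsProper π := hi ▸ inferInstance
  let V : X.Opens := i ⁻¹ᵁ Proj.basicOpen (grading n R) f ⊔ i ⁻¹ᵁ Proj.basicOpen (grading n R) g
  -- Properness spreads the absence of common zeros from the fibre over `m` to a neighbourhood.
  have hclosed : IsClosed (π '' (V : Set X)ᶜ) := π.isClosedMap _ V.isOpen.isClosed_compl
  have hmem : m ∈ (π '' (V : Set X)ᶜ)ᶜ := by
    rintro ⟨x, hx, hxm⟩
    exact hx (hfg x hxm)
  obtain ⟨U, hU, hmU, hUV⟩ : ∃ U : (Spec (.of R)).Opens, IsAffineOpen U ∧ m ∈ U ∧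
      (U : Set (Spec (.of R))) ⊆ (π '' (V : Set X)ᶜ)ᶜ := by
    obtain ⟨_, ⟨U, hU, rfl⟩, hmU, hUV⟩ :=
      (Spec (.of R)).isBasis_affineOpens.exists_subset_of_mem_open hmem hclosed.isOpen_compl
    exact ⟨U, hU, hmU, hUV⟩
  let Y := (π ⁻¹ᵁ U).toScheme
  let j : Y ⟶ Proj (grading n R) := (π ⁻¹ᵁ U).ι ≫ i
  have hYV (y : Y) : (π ⁻¹ᵁ U).ι y ∈ V := by
    by_contra h
    exact hUV y.2 ⟨_, h, rfl⟩
  have hj : IsAffineHom j := by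
    have : IsAffine U := hU
    have : IsAffineHom U.ι := inferInstance
    have : IsAffineHom (π ⁻¹ᵁ U).ι :=
      MorphismProperty.of_isPullback (isPullback_morphismRestrict π U) this
    have : IsAffineHom i := inferInstance
    exact inferInstanceAs (IsAffineHom ((π ⁻¹ᵁ U).ι ≫ i))
  let h : Γ(Spec (.of R), U) →+* Γ(Y, ⊤) := (U.topIso.inv ≫ (π ∣_ U).appTop).hom
  let F : Fin 2 → MvPolynomial (Fin (n + 1)) R := ![f, g]
  have hF : ∀ k, F k ∈ grading n R d := by
    intro k
    fin_cases k
    · exact hf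
    · exact hg
  obtain ⟨ρ, hρ, hρX⟩ := exists_toProjectiveSpace (grading n R) j h hd F hF (by
    refine TopologicalSpace.IsOpenCover.mk ?_
    refine top_le_iff.mp fun y _ ↦ TopologicalSpace.Opens.mem_iSup.mpr ?_
    rcases hYV y with hy | hy
    · exact ⟨0, hy⟩
    · exact ⟨1, hy⟩)
  have hcomp : ρ ≫ projectiveSpaceToOpen 1 hU = π ∣_ U := by
    rw [projectiveSpaceToOpen, reassoc_of% hρ, ← Category.assoc, Iso.comp_inv_eq,
      IsAffineOpen.isoSpec_hom, Scheme.Opens.toSpecΓ]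
    have hh : Spec.map (CommRingCat.ofHom h) =
        Spec.map (π ∣_ U).appTop ≫ Spec.map U.topIso.inv := Spec.map_comp _ _
    rw [hh]
    exact (Scheme.toSpecΓ_naturality_assoc (π ∣_ U) _).symm
  refine ⟨U, hU, hmU, ρ, hcomp, ?_⟩
  have : IsAffineHom ρ := by
    refine isAffineHom_of_preimage_basicOpen_X ρ fun k ↦ ?_
    rw [hρX]
    exact (Proj.isAffineOpen_basicOpen (grading n R) _ (hF k) hd).preimage j
  have : IsSeparated (projectiveSpaceToOpen 1 hU) := by
    rw [projectiveSpaceToOpen]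
    infer_instance
  have : IsProper (ρ ≫ projectiveSpaceToOpen 1 hU) := by
    rw [hcomp]
    infer_instance
  exact IsFinite.iff_isProper_and_isAffineHom.mpr
    ⟨IsProper.of_comp ρ (projectiveSpaceToOpen 1 hU), inferInstance⟩

lemma exists_isMaximal_specializes {R : Type u} [CommRing R] (s : Spec (.of R)) :
    ∃ m : Spec (.of R), m.asIdeal.IsMaximal ∧ s ⤳ m := by
  obtain ⟨M, hM, hsM⟩ := Ideal.exists_le_maximal s.asIdeal s.2.ne_top
  exact ⟨⟨M, hM.isPrime⟩, hM, (PrimeSpectrum.le_iff_specializes _ _).mp hsM⟩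

end

end ArithSurf

theorem mainTheorem12 {R : Type u} [CommRing R] [IsDomain R] {X : Scheme.{u}}
    (π : X ⟶ Spec (.of R)) (hπ : ArithSurf.IsArithmeticSurface π)
    (s : ↥(Spec (.of R))) :
    ∃ (U : (Spec (.of R)).Opens) (hU : IsAffineOpen U), s ∈ U ∧
      ∃ ρ : (π ⁻¹ᵁ U).toScheme ⟶ ArithSurf.projectiveSpace 1 Γ(Spec (.of R), U),
        ρ ≫ ArithSurf.projectiveSpaceToOpen 1 hU = π ∣_ U ∧ IsFinite ρ := by
  have := hπ.isDedekindDomain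
  have := hπ.charZero
  have := hπ.flat
  have := hπ.irreducible_genericFiber
  -- Any open set containing a specialization `m` of `s` contains `s`, so closed points suffice.
  obtain ⟨m, hmax, hsm⟩ := ArithSurf.exists_isMaximal_specializes s
  -- This rules out `R` being a field: its residue field would be `R` itself, infinite in
  -- characteristic zero.
  have hm : m.asIdeal ≠ ⊥ := by
    intro h
    have := hπ.finite_residueField m.asIdeal hmax
    rw [h] at this
    have : Finite R := .of_equiv _ (RingEquiv.quotientBot R).toEquiv
    exact not_finite R
  obtain ⟨U, hU, hmU, hρ⟩ := ArithSurf.exists_finite_of_isMaximal π hπ.dim_genericFiber.le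
    hπ.projective m hm
  exact ⟨U, hU, hsm.mem_open U.isOpen hmU, hρ⟩
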